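/- Let $\Omega\subset\mathbb{C}$ be a non-empty open connected set, $\Omega^*=\{\lambda:\overline{\lambda}\in\Omega\}$, and let $n\ge 1$. The Cowen–Douglas class $\mathcal{B}_n(\Omega)$ consists of the bounded operators $T$ on a complex Hilbert space $\mathcal{H}$ such that $\Omega\subset\sigma(T)$, and $\operatorname{ran}(T-\lambda)=\mathcal{H}$ and $\dim\ker(T-\lambda)=n$ for every $\lambda\in\Omega$, and the closed linear span of $\bigcup_{\lambda\in\Omega}\ker(T-\lambda)$ is $\mathcal{H}$. Let $T,S\in\mathcal{B}_n(\Omega)$ with $T=(M_z^*,\mathcal{H}_T,K_T)$ and $S=(M_z^*,\mathcal{H}_S,K_S)$; that is, $\mathcal{H}_T$ and $\mathcal{H}_S$ are reproducing kernel Hilbert spaces of holomorphic $\mathbb{C}^n$-valued functions on $\Omega^*$ whose $n\times n$ matrix-valued reproducing kernels $K_T,K_S$ have $K_T(\lambda,\lambda)$ and $K_S(\lambda,\lambda)$ invertible for every $\lambda\in\Omega^*$, and $T$ and $S$ are the adjoints of the operators of multiplication by the coordinate function $z$ on $\mathcal{H}_T$ and $\mathcal{H}_S$, respectively. Then $T$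 and $S$ are unitarily equivalent (i.e. there is a unitary $U:\mathcal{H}_T\to\mathcal{H}_S$ with $UT=SU$) if and only if there are a non-empty open set $\Lambda\subset\Omega^*$ and a holomorphic function $\Psi$ on $\Lambda$ with values in the $n\times n$ complex matrices, with $\Psi(\lambda)$ invertible for every $\lambda\in\Lambda$, such that $$\frac{\partial}{\partial\lambda}\bigl[K_T(\lambda,\lambda)^{-1}\,\Psi(\lambda)^{-1}\,K_S(\lambda,\lambda)\bigr]=0\qquad\text{for all }\lambda\in\Lambda,$$ where $\frac{\partial}{\partial\lambda}=\frac12\bigl(\frac{\partial}{\partial x}-i\frac{\partial}{\partial y}\bigr)$, $\lambda=x+iy$, is applied entrywise. -/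

import Mathlib

open scoped ComplexConjugate

noncomputable section

namespace CowenDouglasRK

/-- The conjugate domain `Ω* = {z : conj z ∈ Ω}`. -/
def conjDomain (Ω : Set ℂ) : Set ℂ := {z | conj z ∈ Ω}

/-- The Cowen-Douglas class `B_n(Ω)` of bounded operators on a Hilbert space. -/
structure CowenDouglas {H : Type*} [NormedAddCommGroup H] [InnerProductSpace ℂ H]
    (n : ℕ) (Ω : Set ℂ) (T : H →L[ℂ] H) : Prop where
  subset_spectrum : Ω ⊆ spectrum ℂ T
  surjective : ∀ w ∈ Ω, Function.Surjective (T - w • ContinuousLinearMap.id ℂ H)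
  dense_span :
    (⨆ w ∈ Ω, (T - w • ContinuousLinearMap.id ℂ H).ker).topologicalClosure = ⊤
  rank_ker : ∀ w ∈ Ω, Module.rank ℂ (T - w • ContinuousLinearMap.id ℂ H).ker = n

/-- Unitary equivalence of bounded operators on two Hilbert spaces. -/
def UnitarilyEquivalent {H₁ H₂ : Type*} [NormedAddCommGroup H₁] [InnerProductSpace ℂ H₁]
    [NormedAddCommGroup H₂] [InnerProductSpace ℂ H₂]
    (T : H₁ →L[ℂ] H₁) (S : H₂ →L[ℂ] H₂) : Prop :=
  ∃ U : H₁ ≃ₗᵢ[ℂ] H₂, ∀ x, U (T x) = S (U x)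

section Kernel

variable {n : ℕ} {D : Set ℂ} (H : Type*) [NormedAddCommGroup H] [InnerProductSpace ℂ H]
  [CompleteSpace H] [RKHS ℂ H D (EuclideanSpace ℂ (Fin n))]

/-- The reproducing kernel `K(z, w)` as an `n × n` complex matrix: the value at `z` of the
kernel function `K(·, w) ξ` is `K(z, w)` applied to `ξ`. -/
def kernelMatrix (z w : D) : Matrix (Fin n) (Fin n) ℂ :=
  (Matrix.toEuclideanCLM (n := Fin n) (𝕜 := ℂ)).symm (RKHS.kernel H z w)

/-- The function `z ↦ K(z, z)`, extended by zero outside the domain `D` of the function space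
so that it can be differentiated at points of `D`. -/
def diagKernel : ℂ → Matrix (Fin n) (Fin n) ℂ :=
  Function.extend Subtype.val (fun z : D => kernelMatrix H z z) 0

end Kernel

/-- `T = (M_z^*, H, K)`: the Hilbert space `H` consists of holomorphic `ℂⁿ`-valued functions
on `D` and has a reproducing kernel `K` with `K(z, z)` invertible for every `z ∈ D`, and `T` is
the adjoint of multiplication by the coordinate function on `H`. -/
structure IsAdjointMulModel {n : ℕ} {D : Set ℂ} {H : Type*} [NormedAddCommGroup H]
    [InnerProductSpace ℂ H] [CompleteSpace H] [RKHS ℂ H D (EuclideanSpace ℂ (Fin n))]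
    (T : H →L[ℂ] H) : Prop where
  holomorphic : ∀ f : H, DifferentiableOn ℂ (Function.extend Subtype.val (⇑f) 0) D
  adjoint_apply : ∀ (f : H) (z : D), (ContinuousLinearMap.adjoint T f) z = (z : ℂ) • f z
  isUnit_kernel : ∀ z : D, IsUnit (kernelMatrix H z z)

/-- The Wirtinger derivative `∂f/∂z = (∂f/∂x - i ∂f/∂y) / 2`. -/
def wirtinger (f : ℂ → ℂ) (z : ℂ) : ℂ :=
  (fderiv ℝ f z 1 - Complex.I * fderiv ℝ f z Complex.I) / 2

/-- The matrix-valued function `F` is (real) differentiable at `z` and `∂F/∂z = 0` there. -/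
def WirtingerDerivEqZeroAt {n : ℕ} (F : ℂ → Matrix (Fin n) (Fin n) ℂ) (z : ℂ) : Prop :=
  ∀ i j, DifferentiableAt ℝ (fun w => F w i j) z ∧ wirtinger (fun w => F w i j) z = 0

end CowenDouglasRK

end

open scoped ComplexConjugate

noncomputable section

namespace CowenDouglasRK

section

open scoped Matrix ComplexOrder MatrixOrder

section MatrixLemmas

variable {m : Type*} [Fintype m] [DecidableEq m]

/-- A positive definite matrix has a positive definite square root. -/
lemma exists_posDef_mul_self {M : Matrix m m ℂ} (hM : M.PosDef) :
    ∃ P : Matrix m m ℂ, P.PosDef ∧ P * P = M := by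
  have hs : CFC.sqrt M * CFC.sqrt M = M := CFC.sqrt_mul_sqrt_self M hM.posSemidef.nonneg
  refine ⟨CFC.sqrt M, ?_, hs⟩
  have h0 : (CFC.sqrt M).PosSemidef := 
    Matrix.nonneg_iff_posSemidef.1 (CFC.sqrt_nonneg M)
  rw [h0.posDef_iff_isUnit]
  exact isUnit_of_mul_isUnit_left (hs.symm ▸ hM.isUnit)

/-- The homogeneous Sylvester equation with positive definite coefficients has only the zero
solution. -/
lemma eq_zero_of_mul_add_mul_eq_zero {A B W : Matrix m m ℂ} (hA : A.PosDef) (hB : B.PosDef)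
    (h : A * W + W * B = 0) : W = 0 := by
  have h1 : (Wᴴ * A * W).PosSemidef := hA.posSemidef.conjTranspose_mul_mul_same W
  have h2 : (W * B * Wᴴ).PosSemidef := hB.posSemidef.mul_mul_conjTranspose_same W
  have h3 : (Wᴴ * A * W).trace + (W * B * Wᴴ).trace = 0 := by
    rw [Matrix.trace_mul_comm (W * B), ← Matrix.trace_add, Matrix.mul_assoc, ← Matrix.mul_add, h,
      Matrix.mul_zero, Matrix.trace_zero]
  have h4 : (Wᴴ * A * W).trace = 0 :=
    le_antisymm (by rw [eq_neg_of_add_eq_zero_left h3]; simpa using h2.trace_nonneg)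
      h1.trace_nonneg
  obtain ⟨P, hP, rfl⟩ := exists_posDef_mul_self hA
  rw [h1.trace_eq_zero_iff] at h4
  have h5 : (P * W)ᴴ * (P * W) = 0 := by
    rw [Matrix.conjTranspose_mul, hP.isHermitian.eq, ← h4]
    simp only [Matrix.mul_assoc]
  rw [Matrix.conjTranspose_mul_self_eq_zero] at h5
  exact hP.isUnit.mul_right_eq_zero.1 h5

/-- A matrix intertwining the squares of two positive definite matrices intertwines the matrices. -/
lemma mul_eq_mul_of_mul_self {A B X : Matrix m m ℂ} (hA : A.PosDef) (hB : B.PosDef)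
    (h : A * A * X = X * (B * B)) : A * X = X * B := by
  refine sub_eq_zero.1 (eq_zero_of_mul_add_mul_eq_zero hA hB ?_)
  rw [Matrix.mul_sub, Matrix.sub_mul, ← Matrix.mul_assoc, h]
  simp only [Matrix.mul_assoc]
  abel

/-- If two Hermitian kernels with positive definite diagonals are related by
`K_S(z, w) = Ψ(z) K_T(z, w) G(w)`, then they are related by a congruence. -/
lemma exists_congruence {ι : Type*} {KT KS : ι → ι → Matrix m m ℂ}
    (hT : ∀ z w, (KT z w)ᴴ = KT w z) (hS : ∀ z w, (KS z w)ᴴ = KS w z)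
    (hTpos : ∀ z, (KT z z).PosDef) (hSpos : ∀ z, (KS z z).PosDef)
    {Ψ G : ι → Matrix m m ℂ} (hΨ : ∀ z, IsUnit (Ψ z))
    (h : ∀ z w, KS z w = Ψ z * KT z w * G w) :
    ∃ Φ : ι → Matrix m m ℂ, (∀ z, IsUnit (Φ z)) ∧ ∀ z w, KS z w = Φ z * KT z w * (Φ w)ᴴ := by
  choose p hp hpp using fun z => exists_posDef_mul_self (hTpos z)
  let q z := (p z)⁻¹
  have hpu z : IsUnit (p z).det := (Matrix.isUnit_iff_isUnit_det _).1 (hp z).isUnit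
  have hqp z : q z * p z = 1 := Matrix.nonsing_inv_mul _ (hpu z)
  have hpq z : p z * q z = 1 := Matrix.mul_nonsing_inv _ (hpu z)
  have hpH z : (p z)ᴴ = p z := (hp z).isHermitian.eq
  have hqH z : (q z)ᴴ = q z := by simp only [q, Matrix.conjTranspose_nonsing_inv, hpH]
  let E z := Ψ z * p z
  have hE z : IsUnit (E z) := (hΨ z).mul (hp z).isUnit
  let F z := (E z)⁻¹
  have hEu z : IsUnit (E z).det := (Matrix.isUnit_iff_isUnit_det _).1 (hE z)
  have hFE z : F z * E z = 1 := Matrix.nonsing_inv_mul _ (hEu z)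
  have hEF z : E z * F z = 1 := Matrix.mul_nonsing_inv _ (hEu z)
  have hFEH z : (F z)ᴴ * (E z)ᴴ = 1 := by
    rw [← Matrix.conjTranspose_mul, hEF, Matrix.conjTranspose_one]
  let C z w := q z * KT z w * q w
  have hC z w : (C z w)ᴴ = C w z := by
    simp only [C, Matrix.conjTranspose_mul, hT, hqH, Matrix.mul_assoc]
  have hCK z w : p z * C z w * p w = KT z w := by
    simp only [C, ← Matrix.mul_assoc, hpq, Matrix.one_mul]
    rw [Matrix.mul_assoc, hqp, Matrix.mul_one]
  have hFu z : IsUnit (F z) := IsUnit.of_mul_eq_one _ (hFE z)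
  let P z := F z * KS z z * (F z)ᴴ
  have hP z : (P z).PosDef := (Matrix.IsUnit.posDef_star_right_conjugate_iff (hFu z)).2 (hSpos z)
  have hPH z : (P z)ᴴ = P z := (hP z).isHermitian.eq
  have hG z : p z * G z = P z * (E z)ᴴ := by
    have h1 : KS z z = E z * (p z * G z) := by
      rw [h, ← hpp]; simp only [E, Matrix.mul_assoc]
    calc p z * G z = F z * E z * (p z * G z) := by rw [hFE, Matrix.one_mul]
      _ = F z * KS z z * ((F z)ᴴ * (E z)ᴴ) := by
        rw [hFEH, h1]; simp only [Matrix.mul_assoc, Matrix.mul_one]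
      _ = P z * (E z)ᴴ := by simp only [P, Matrix.mul_assoc]
  have hKS z w : KS z w = E z * (C z w * P w) * (E w)ᴴ := by
    rw [h, ← hCK]
    calc _ = E z * C z w * (p w * G w) := by simp only [E, Matrix.mul_assoc]
      _ = _ := by rw [hG]; simp only [Matrix.mul_assoc]
  have hKS' z w : KS z w = E z * (P z * C z w) * (E w)ᴴ := by
    rw [← hS, hKS]
    simp only [Matrix.conjTranspose_mul, Matrix.conjTranspose_conjTranspose, hPH, hC,
      Matrix.mul_assoc]
  have hPC z w : P z * C z w = C z w * P w := by
    have h1 := (hKS' z w).symm.trans (hKS z w)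
    have h2 := (hE z).mul_right_injective.eq_iff.1
      (((hE w).star.mul_left_injective.eq_iff.1 h1))
    exact h2
  choose R hR hRR using fun z => exists_posDef_mul_self (hP z)
  have hRC z w : R z * C z w = C z w * R w :=
    mul_eq_mul_of_mul_self (hR z) (hR w) (by rw [hRR, hRR, hPC])
  refine ⟨fun z => E z * R z * q z, fun z =>
    ((hE z).mul (hR z).isUnit).mul (IsUnit.of_mul_eq_one _ (hqp z)), fun z w => ?_⟩
  have hRH z : (R z)ᴴ = R z := (hR z).isHermitian.eq
  calc KS z w = E z * (C z w * (R w * R w)) * (E w)ᴴ := by rw [hKS, hRR]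
    _ = E z * (R z * C z w * R w) * (E w)ᴴ := by rw [hRC]; simp only [Matrix.mul_assoc]
    _ = _ := by simp only [C, Matrix.conjTranspose_mul, hRH, hqH, Matrix.mul_assoc]

end MatrixLemmas

end

open Filter Topology Metric Set

section Holomorphy

/-- A Hilbert-space-valued function that is weakly holomorphic on an open set is holomorphic. -/
lemma differentiableOn_of_forall_inner {E : Type*} [NormedAddCommGroup E] [InnerProductSpace ℂ E]
    [CompleteSpace E] {k : ℂ → E} {U : Set ℂ} (hU : IsOpen U)
    (h : ∀ f : E, DifferentiableOn ℂ (fun u => inner ℂ f (k u)) U) : DifferentiableOn ℂ k U := by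
  intro z hz
  obtain ⟨r, hr, hrU⟩ := nhds_basis_closedBall.mem_iff.1 (hU.mem_nhds hz)
  let s : Set ℂ := closedBall z r \ {z}
  have hslope (f : E) (w : ℂ) :
      slope (fun u => inner ℂ f (k u)) z w = inner ℂ f (slope k z w) := by
    simp only [slope_def_module, inner_smul_right, inner_sub_right, smul_eq_mul]
  have hLip (f : E) : ∃ C : ℝ, ∀ p ∈ s, ∀ q ∈ s,
      ‖inner ℂ f (slope k z p - slope k z q)‖ ≤ C * ‖p - q‖ := by
    have hd : DifferentiableOn ℂ (dslope (fun u => inner ℂ f (k u)) z) U :=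
      (Complex.differentiableOn_dslope (hU.mem_nhds hz)).2 (h f)
    obtain ⟨C, hC⟩ := (isCompact_closedBall z r).exists_bound_of_continuousOn
      ((hd.deriv hU).continuousOn.mono hrU)
    refine ⟨C, fun p hp q hq => ?_⟩
    have := (convex_closedBall z r).norm_image_sub_le_of_norm_deriv_le
      (fun x hx => (hd.differentiableAt (hU.mem_nhds (hrU hx)))) hC hq.1 hp.1
    rwa [dslope_of_ne _ hp.2, dslope_of_ne _ hq.2, hslope, hslope, ← inner_sub_right] at this
  obtain ⟨C, hC⟩ := banach_steinhaus (𝕜 := ℂ) (𝕜₂ := ℂ)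
    (g := fun p : s × s => innerSL ℂ (((p.1 : ℂ) - p.2)⁻¹ • (slope k z p.1 - slope k z p.2)))
    (by
      intro f
      obtain ⟨C, hC⟩ := hLip f
      refine ⟨|C|, fun p => ?_⟩
      rw [innerSL_apply_apply, norm_inner_symm, inner_smul_right, norm_mul, norm_inv]
      rcases eq_or_ne ((p.1 : ℂ) - p.2) 0 with h0 | h0
      · simp [h0]
      · rw [inv_mul_le_iff₀ (norm_pos_iff.2 h0), mul_comm]
        exact (hC _ p.1.2 _ p.2.2).trans
          (mul_le_mul_of_nonneg_right (le_abs_self C) (norm_nonneg _)))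
  have hLs : LipschitzOnWith C.toNNReal (slope k z) s := by
    refine LipschitzOnWith.of_dist_le' fun p hp q hq => ?_
    have := hC (⟨p, hp⟩, ⟨q, hq⟩)
    rw [innerSL_apply_norm, norm_smul, norm_inv] at this
    rcases eq_or_ne p q with rfl | hne
    · simp
    · rw [dist_eq_norm, dist_eq_norm, mul_comm]
      rwa [inv_mul_le_iff₀ (norm_pos_iff.2 (sub_ne_zero.2 hne))] at this
  have hle : 𝓝[≠] z ≤ 𝓟 s := by
    rw [le_principal_iff]
    exact inter_mem (mem_nhdsWithin_of_mem_nhds (closedBall_mem_nhds z hr)) self_mem_nhdsWithin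
  obtain ⟨d, hd⟩ := CompleteSpace.complete
    ((cauchy_nhds (a := z)).mono nhdsWithin_le_nhds |>.map_of_le hLs.uniformContinuousOn hle)
  exact (hasDerivAt_iff_tendsto_slope.2 hd).differentiableAt.differentiableWithinAt

/-- A holomorphic function on a disc that vanishes at the points with the same imaginary part as
the centre vanishes identically. -/
lemma eq_zero_of_eq_zero_on_real {g : ℂ → ℂ} {c r : ℝ} (hg : DifferentiableOn ℂ g (ball (c : ℂ) r))
    (h0 : ∀ t : ℝ, (t : ℂ) ∈ ball (c : ℂ) r → g t = 0) {a : ℂ} (ha : a ∈ ball (c : ℂ) r) :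
    g a = 0 := by
  have hr : 0 < r := pos_of_mem_ball ha
  have hfreq : ∃ᶠ w in 𝓝[≠] (c : ℂ), g w = 0 := by
    have ht : Tendsto (fun t : ℝ => (t : ℂ)) (𝓝[≠] c) (𝓝[≠] (c : ℂ)) := by
      refine tendsto_nhdsWithin_iff.2 ⟨Complex.continuous_ofReal.continuousAt.mono_left
        nhdsWithin_le_nhds, ?_⟩
      filter_upwards [self_mem_nhdsWithin] with t ht
      simpa using ht
    refine ht.frequently (Eventually.frequently ?_)
    filter_upwards [mem_nhdsWithin_of_mem_nhds (ball_mem_nhds c hr)] with t ht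
    refine h0 t ?_
    rw [mem_ball, Complex.dist_of_im_eq (by simp)]
    simpa using ht
  exact (hg.analyticOnNhd isOpen_ball).eqOn_zero_of_preconnected_of_frequently_eq_zero
    (convex_ball _ _).isPreconnected (mem_ball_self hr) hfreq ha

/-- Polarization: a holomorphic function of two variables that vanishes on the antidiagonal
`u = conj z` near a point vanishes near that point. -/
lemma eq_zero_of_eq_zero_on_conj {f : ℂ × ℂ → ℂ} {c : ℂ} {r : ℝ}
    (hf : DifferentiableOn ℂ f (ball c r ×ˢ ball (conj c) r))
    (h0 : ∀ z ∈ ball c r, f (z, conj z) = 0) {z u : ℂ} (hz : z ∈ ball c (r / 2))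
    (hu : u ∈ ball (conj c) (r / 2)) : f (z, u) = 0 := by
  let L : ℂ × ℂ → ℂ × ℂ := fun p => (p.1 + Complex.I * p.2, p.1 - Complex.I * p.2)
  have hc : c = c.re + Complex.I * c.im := by rw [mul_comm]; exact (Complex.re_add_im c).symm
  have hcc : conj c = c.re - Complex.I * c.im := by
    conv_lhs => rw [hc]
    simp [sub_eq_add_neg]
  have hL : ∀ a ∈ ball (c.re : ℂ) (r / 2), ∀ b ∈ ball (c.im : ℂ) (r / 2),
      L (a, b) ∈ ball c r ×ˢ ball (conj c) r := by
    intro a ha b hb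
    rw [mem_ball_iff_norm] at ha hb
    have hI : ‖Complex.I * (b - c.im)‖ < r / 2 := by simpa using hb
    constructor
    · rw [mem_ball_iff_norm]
      have h1 : a + Complex.I * b - c = (a - c.re) + Complex.I * (b - c.im) := by
        conv_lhs => rw [hc]
        ring
      rw [h1]
      exact (norm_add_le _ _).trans_lt (by linarith)
    · rw [mem_ball_iff_norm]
      have h1 : a - Complex.I * b - conj c = (a - c.re) - Complex.I * (b - c.im) := by
        rw [hcc]; ring
      rw [h1]
      exact (norm_sub_le _ _).trans_lt (by linarith)
  have hLd : Differentiable ℂ L := by fun_prop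
  have hopen : IsOpen (ball c r ×ˢ ball (conj c) r) := isOpen_ball.prod isOpen_ball
  have hfd : ∀ a ∈ ball (c.re : ℂ) (r / 2), ∀ b ∈ ball (c.im : ℂ) (r / 2),
      DifferentiableAt ℂ (f ∘ L) (a, b) := fun a ha b hb =>
    (hf.differentiableAt (hopen.mem_nhds (hL a ha b hb))).comp _ (hLd _)
  have h1 : ∀ b : ℝ, (b : ℂ) ∈ ball (c.im : ℂ) (r / 2) → ∀ a ∈ ball (c.re : ℂ) (r / 2),
      f (L (a, b)) = 0 := by
    intro b hb a ha
    refine eq_zero_of_eq_zero_on_real (g := fun a => f (L (a, b))) (fun a ha =>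
      ((hfd a ha b hb).comp (f := fun a : ℂ => (a, (b : ℂ))) a (by fun_prop)).differentiableWithinAt)
      (fun t ht => ?_) ha
    have h2 : L (t, b) = (t + Complex.I * b, conj (t + Complex.I * b)) := by
      simp [L, sub_eq_add_neg]
    rw [h2]
    exact h0 _ (hL t ht b hb).1
  have h2 : ∀ a ∈ ball (c.re : ℂ) (r / 2), ∀ b ∈ ball (c.im : ℂ) (r / 2), f (L (a, b)) = 0 := by
    intro a ha b hb
    exact eq_zero_of_eq_zero_on_real (g := fun b => f (L (a, b))) (fun b hb =>
      ((hfd a ha b hb).comp (f := fun b : ℂ => (a, b)) b (by fun_prop)).differentiableWithinAt)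
      (fun t ht => h1 t ht a ha) hb
  have ha : (z + u) / 2 ∈ ball (c.re : ℂ) (r / 2) := by
    rw [mem_ball_iff_norm] at hz hu ⊢
    have : (z + u) / 2 - c.re = ((z - c) + (u - conj c)) / 2 := by
      rw [hcc]; nth_rewrite 2 [hc]; ring
    rw [this, norm_div, Complex.norm_ofNat]
    linarith [norm_add_le (z - c) (u - conj c)]
  have hb : (z - u) / (2 * Complex.I) ∈ ball (c.im : ℂ) (r / 2) := by
    rw [mem_ball_iff_norm] at hz hu ⊢
    have : (z - u) / (2 * Complex.I) - c.im = ((z - c) - (u - conj c)) / (2 * Complex.I) := by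
      rw [hcc]; nth_rewrite 2 [hc]; field_simp; ring
    rw [this, norm_div, norm_mul, Complex.norm_ofNat, Complex.norm_I]
    linarith [norm_sub_le (z - c) (u - conj c)]
  have h3 : L ((z + u) / 2, (z - u) / (2 * Complex.I)) = (z, u) := by
    simp only [L, Prod.mk.injEq]
    constructor <;> field_simp <;> ring
  rw [← h3]
  exact h2 _ ha _ hb

/-- A real-differentiable function with `∂f/∂z = 0` is antiholomorphic. -/
lemma differentiableAt_comp_conj_of_wirtinger {f : ℂ → ℂ} {u : ℂ}
    (hf : DifferentiableAt ℝ f (conj u)) (h : wirtinger f (conj u) = 0) :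
    DifferentiableAt ℂ (fun v => f (conj v)) u := by
  have hd : HasFDerivAt (fun v => f (conj v))
      ((fderiv ℝ f (conj u)).comp (Complex.conjCLE : ℂ →L[ℝ] ℂ)) u :=
    HasFDerivAt.comp (f := fun v => conj v) u hf.hasFDerivAt Complex.conjCLE.hasFDerivAt
  rw [differentiableAt_complex_iff_differentiableAt_real]
  refine ⟨hd.differentiableAt, ?_⟩
  rw [hd.fderiv]
  simp only [wirtinger, div_eq_zero_iff, OfNat.ofNat_ne_zero, or_false] at h
  have h1 := sub_eq_zero.1 h
  simp only [ContinuousLinearMap.comp_apply, ContinuousLinearEquiv.coe_coe, Complex.conjCLE_apply,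
    Complex.conj_I, map_neg, map_one, smul_eq_mul]
  rw [h1, ← mul_assoc, Complex.I_mul_I, neg_one_mul]

/-- The complex conjugate of a holomorphic function satisfies `∂f/∂z = 0`. -/
lemma wirtinger_conj {g : ℂ → ℂ} {z : ℂ} (hg : DifferentiableAt ℂ g z) :
    DifferentiableAt ℝ (fun w => conj (g w)) z ∧ wirtinger (fun w => conj (g w)) z = 0 := by
  obtain ⟨h1, h2⟩ := differentiableAt_complex_iff_differentiableAt_real.1 hg
  have hd : HasFDerivAt (fun w => conj (g w))
      ((Complex.conjCLE : ℂ →L[ℝ] ℂ).comp (fderiv ℝ g z)) z :=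
    Complex.conjCLE.hasFDerivAt.comp z h1.hasFDerivAt
  refine ⟨hd.differentiableAt, ?_⟩
  rw [wirtinger, hd.fderiv]
  simp only [ContinuousLinearMap.comp_apply, ContinuousLinearEquiv.coe_coe, Complex.conjCLE_apply,
    h2, smul_eq_mul, map_mul, Complex.conj_I]
  rw [← mul_assoc, mul_neg, Complex.I_mul_I]
  simp

lemma WirtingerDerivEqZeroAt.congr {n : ℕ} {F G : ℂ → Matrix (Fin n) (Fin n) ℂ} {z : ℂ}
    (hG : WirtingerDerivEqZeroAt G z) (h : F =ᶠ[𝓝 z] G) : WirtingerDerivEqZeroAt F z := by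
  intro i j
  have hij : (fun w => F w i j) =ᶠ[𝓝 z] fun w => G w i j := h.mono fun w hw => by simp [hw]
  refine ⟨(hG i j).1.congr_of_eventuallyEq hij, ?_⟩
  rw [wirtinger, hij.fderiv_eq]
  exact (hG i j).2

section MatrixValued

variable {m : Type*} [Fintype m] {U : Set ℂ}

lemma differentiableOn_matrix_mul {A B : ℂ → Matrix m m ℂ}
    (hA : ∀ i j, DifferentiableOn ℂ (fun z => A z i j) U)
    (hB : ∀ i j, DifferentiableOn ℂ (fun z => B z i j) U) (i j : m) :
    DifferentiableOn ℂ (fun z => (A z * B z) i j) U := by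
  simp only [Matrix.mul_apply]
  exact DifferentiableOn.fun_sum fun l _ => (hA i l).mul (hB l j)

variable [DecidableEq m]

lemma differentiableOn_matrix_det {A : ℂ → Matrix m m ℂ}
    (hA : ∀ i j, DifferentiableOn ℂ (fun z => A z i j) U) :
    DifferentiableOn ℂ (fun z => (A z).det) U := by
  simp only [Matrix.det_apply]
  refine DifferentiableOn.fun_sum fun σ _ => DifferentiableOn.fun_const_smul ?_ _
  exact DifferentiableOn.fun_finsetProd fun l _ => hA _ _

lemma differentiableOn_matrix_inv {A : ℂ → Matrix m m ℂ}
    (hA : ∀ i j, DifferentiableOn ℂ (fun z => A z i j) U) (hdet : ∀ z ∈ U, (A z).det ≠ 0)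
    (i j : m) : DifferentiableOn ℂ (fun z => (A z)⁻¹ i j) U := by
  simp only [Matrix.inv_def, Matrix.smul_apply, smul_eq_mul, Ring.inverse_eq_inv',
    Matrix.adjugate_apply]
  refine ((differentiableOn_matrix_det hA).inv hdet).mul (differentiableOn_matrix_det ?_)
  intro k l
  simp only [Matrix.updateRow_apply]
  split_ifs
  · exact differentiableOn_const _
  · exact hA k l

end MatrixValued

end Holomorphy

open RKHS
open scoped InnerProductSpace Matrix

lemma denseRange_linearCombination {K ι : Type*} [NormedAddCommGroup K] [InnerProductSpace ℂ K]
    {g : ι → K} (hg : (Submodule.span ℂ (range g)).topologicalClosure = ⊤) :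
    DenseRange (Finsupp.linearCombination ℂ g) := by
  rw [DenseRange, ← LinearMap.coe_range, Finsupp.range_linearCombination]
  exact Submodule.dense_iff_topologicalClosure_eq_top.2 hg

/-- Two families with the same Gram matrix and dense spans are related by a unitary. -/
lemma exists_linearIsometryEquiv_of_inner_eq {H₁ H₂ : Type*}
    [NormedAddCommGroup H₁] [InnerProductSpace ℂ H₁] [CompleteSpace H₁]
    [NormedAddCommGroup H₂] [InnerProductSpace ℂ H₂] [CompleteSpace H₂]
    {ι : Type*} {e : ι → H₁} {f : ι → H₂} (h : ∀ i j, ⟪e i, e j⟫_ℂ = ⟪f i, f j⟫_ℂ)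
    (he : (Submodule.span ℂ (range e)).topologicalClosure = ⊤)
    (hf : (Submodule.span ℂ (range f)).topologicalClosure = ⊤) :
    ∃ U : H₁ ≃ₗᵢ[ℂ] H₂, ∀ i, U (e i) = f i := by
  have hn (x : ι →₀ ℂ) :
      ‖Finsupp.linearCombination ℂ f x‖ = ‖Finsupp.linearCombination ℂ e x‖ := by
    rw [@norm_eq_sqrt_re_inner ℂ, @norm_eq_sqrt_re_inner ℂ]
    simp only [Finsupp.linearCombination_apply, Finsupp.sum_inner, Finsupp.inner_sum,
      inner_smul_left, inner_smul_right, h]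
  let V := (LinearEquiv.refl ℂ (ι →₀ ℂ)).extendOfIsometry (Finsupp.linearCombination ℂ e)
    (Finsupp.linearCombination ℂ f) (denseRange_linearCombination he)
    (denseRange_linearCombination hf) hn
  refine ⟨V, fun i => ?_⟩
  have := LinearEquiv.extendOfIsometry_eq (LinearEquiv.refl ℂ (ι →₀ ℂ))
    (Finsupp.linearCombination ℂ e) (Finsupp.linearCombination ℂ f)
    (denseRange_linearCombination he) (denseRange_linearCombination hf) hn (Finsupp.single i 1)
  simpa using this

section Kernel

variable {n : ℕ} {D : Set ℂ} (H : Type*) [NormedAddCommGroup H] [InnerProductSpace ℂ H]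
  [CompleteSpace H] [RKHS ℂ H D (EuclideanSpace ℂ (Fin n))]

lemma toEuclideanCLM_kernelMatrix (z w : D) :
    Matrix.toEuclideanCLM (n := Fin n) (𝕜 := ℂ) (kernelMatrix H z w) = kernel H z w :=
  Matrix.toEuclideanCLM.apply_symm_apply _

lemma kernelMatrix_apply (z w : D) (i j : Fin n) :
    kernelMatrix H z w i j = kerFun H w (EuclideanSpace.single j 1) z i := by
  rw [kerFun_apply, ← toEuclideanCLM_kernelMatrix, Matrix.ofLp_toEuclideanCLM]
  simp

lemma inner_kerFun_single (z w : D) (i j : Fin n) :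
    ⟪kerFun H z (EuclideanSpace.single i 1), kerFun H w (EuclideanSpace.single j 1)⟫_ℂ =
      kernelMatrix H z w i j := by
  rw [kerFun_inner, kernelMatrix_apply, EuclideanSpace.inner_single_left]
  simp

lemma conjTranspose_kernelMatrix (z w : D) : (kernelMatrix H z w)ᴴ = kernelMatrix H w z := by
  ext i j
  rw [Matrix.conjTranspose_apply, ← inner_kerFun_single, ← inner_kerFun_single]
  exact inner_conj_symm _ _

lemma inner_single_toEuclideanCLM (M : Matrix (Fin n) (Fin n) ℂ) (i j : Fin n) :
    ⟪(EuclideanSpace.single i 1 : EuclideanSpace ℂ (Fin n)),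
      Matrix.toEuclideanCLM (n := Fin n) (𝕜 := ℂ) M (EuclideanSpace.single j 1)⟫_ℂ = M i j := by
  rw [EuclideanSpace.inner_single_left, Matrix.ofLp_toEuclideanCLM]
  simp

lemma inner_kerFun_toEuclideanCLM (z w : D) (A B : Matrix (Fin n) (Fin n) ℂ)
    (ξ η : EuclideanSpace ℂ (Fin n)) :
    ⟪kerFun H z (Matrix.toEuclideanCLM (n := Fin n) (𝕜 := ℂ) A ξ),
      kerFun H w (Matrix.toEuclideanCLM (n := Fin n) (𝕜 := ℂ) B η)⟫_ℂ =
      ⟪ξ, Matrix.toEuclideanCLM (n := Fin n) (𝕜 := ℂ) (Aᴴ * kernelMatrix H z w * B) η⟫_ℂ := by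
  rw [kerFun_inner, kerFun_apply, ← ContinuousLinearMap.adjoint_inner_right,
    ← ContinuousLinearMap.star_eq_adjoint, ← map_star, ← toEuclideanCLM_kernelMatrix,
    Matrix.star_eq_conjTranspose, map_mul, map_mul]
  rfl

variable {H}

open scoped ComplexOrder in
lemma kernelMatrix_posDef {z : D} (h : IsUnit (kernelMatrix H z z)) :
    (kernelMatrix H z z).PosDef := by
  have hpos : (kernelMatrix H z z).PosSemidef := by
    rw [← Matrix.isPositive_toEuclideanLin_iff, ← Matrix.coe_toEuclideanCLM_eq_toEuclideanLin,
      toEuclideanCLM_kernelMatrix, kernel_apply]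
    exact (ContinuousLinearMap.isPositive_adjoint_comp_self (kerFun H z)).toLinearMap
  exact (hpos.posDef_iff_isUnit).2 h

variable (H)

lemma diagKernel_apply (z : D) : diagKernel H (z : ℂ) = kernelMatrix H z z :=
  Subtype.val_injective.extend_apply _ _ _

/-- The kernel function at `conj u`, extended by zero: as a function of `u` it is holomorphic. -/
def conjKerFun (η : EuclideanSpace ℂ (Fin n)) (u : ℂ) : H :=
  Function.extend Subtype.val (fun w : D => kerFun H w η) 0 (conj u)

lemma conjKerFun_conj (η : EuclideanSpace ℂ (Fin n)) (w : D) :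
    conjKerFun H η (conj (w : ℂ)) = kerFun H w η := by
  rw [conjKerFun, Complex.conj_conj]
  exact Subtype.val_injective.extend_apply _ _ _

variable {H}

omit [CompleteSpace H] in
lemma differentiableOn_coord
    (hol : ∀ f : H, DifferentiableOn ℂ (Function.extend Subtype.val (⇑f) 0) D) (f : H) (i : Fin n) :
    DifferentiableOn ℂ (fun z => Function.extend Subtype.val (⇑f) 0 z i) D :=
  differentiableOn_euclidean.1 (hol f) i

lemma isOpen_conjDomain {Ω : Set ℂ} (hΩ : IsOpen Ω) : IsOpen (conjDomain Ω) :=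
  hΩ.preimage Complex.continuous_conj

lemma differentiableOn_conjKerFun (hD : IsOpen D)
    (hol : ∀ f : H, DifferentiableOn ℂ (Function.extend Subtype.val (⇑f) 0) D)
    (η : EuclideanSpace ℂ (Fin n)) : DifferentiableOn ℂ (conjKerFun H η) (conjDomain D) := by
  refine differentiableOn_of_forall_inner (isOpen_conjDomain hD) fun f u hu => ?_
  have h1 : DifferentiableAt ℂ (fun z => ⟪η, Function.extend Subtype.val (⇑f) 0 z⟫_ℂ) (conj u) :=
    (innerSL ℂ η).differentiableAt.comp (conj u) ((hol f).differentiableAt (hD.mem_nhds hu))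
  have h2 := h1.conj_conj
  rw [Complex.conj_conj] at h2
  refine (h2.congr_of_eventuallyEq ?_).differentiableWithinAt
  filter_upwards [(isOpen_conjDomain hD).mem_nhds hu] with v hv
  let w : D := ⟨conj v, hv⟩
  have h3 : conjKerFun H η v = kerFun H w η := by
    rw [← conjKerFun_conj]; simp [w]
  have h4 : Function.extend Subtype.val (⇑f) 0 (conj v) = f w :=
    Subtype.val_injective.extend_apply (⇑f) 0 w
  simp only [Function.comp_apply]
  rw [h3, h4, inner_kerFun, inner_conj_symm]

variable (H) in
/-- The entry `K(z, conj u) i j` of the kernel, as a function of the pair `(z, u)`. -/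
def kernelEntry (i j : Fin n) (p : ℂ × ℂ) : ℂ :=
  ⟪conjKerFun H (EuclideanSpace.single i 1) (conj p.1),
    conjKerFun H (EuclideanSpace.single j 1) p.2⟫_ℂ

lemma kernelEntry_apply (i j : Fin n) (z w : D) :
    kernelEntry H i j ((z : ℂ), conj (w : ℂ)) = kernelMatrix H z w i j := by
  rw [kernelEntry, conjKerFun_conj, conjKerFun_conj, inner_kerFun_single]

lemma differentiableOn_kernelEntry (hD : IsOpen D)
    (hol : ∀ f : H, DifferentiableOn ℂ (Function.extend Subtype.val (⇑f) 0) D) (i j : Fin n) :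
    DifferentiableOn ℂ (kernelEntry H i j) (D ×ˢ conjDomain D) := by
  rintro ⟨z, u⟩ ⟨hz, hu⟩
  have hz' : conj z ∈ conjDomain D := by simpa [conjDomain] using hz
  have h1 : DifferentiableAt ℂ (fun z => innerSL ℂ
      (conjKerFun H (EuclideanSpace.single i 1) (conj z))) z :=
    DifferentiableAt.comp_semilinear₂ (innerSL ℂ : H →L⋆[ℂ] H →L[ℂ] ℂ)
      (starL ℂ : ℂ ≃L⋆[ℂ] ℂ).toContinuousLinearMap
      ((differentiableOn_conjKerFun hD hol _).differentiableAt
        ((isOpen_conjDomain hD).mem_nhds hz'))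
  have h2 := (differentiableOn_conjKerFun hD hol (EuclideanSpace.single j 1)).differentiableAt
    ((isOpen_conjDomain hD).mem_nhds hu)
  have h3 : DifferentiableAt ℂ (fun p : ℂ × ℂ => innerSL ℂ
      (conjKerFun H (EuclideanSpace.single i 1) (conj p.1))) (z, u) :=
    DifferentiableAt.comp (g := fun z => innerSL ℂ
      (conjKerFun H (EuclideanSpace.single i 1) (conj z))) (z, u) h1 differentiableAt_fst
  have h4 : DifferentiableAt ℂ (fun p : ℂ × ℂ =>
      conjKerFun H (EuclideanSpace.single j 1) p.2) (z, u) :=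
    DifferentiableAt.comp (g := conjKerFun H (EuclideanSpace.single j 1)) (z, u) h2
      differentiableAt_snd
  exact (h3.clm_apply h4).differentiableWithinAt

/-- The kernel functions over a non-empty open subset of a connected domain are total. -/
lemma span_kerFun_dense (hD : IsOpen D) (hconn : IsPreconnected D)
    (hol : ∀ f : H, DifferentiableOn ℂ (Function.extend Subtype.val (⇑f) 0) D)
    {B : Set ℂ} (hB : IsOpen B) (hne : B.Nonempty) (hBD : B ⊆ D) :
    (Submodule.span ℂ {x : H | ∃ (w : D) (ξ : EuclideanSpace ℂ (Fin n)),
      (w : ℂ) ∈ B ∧ kerFun H w ξ = x}).topologicalClosure = ⊤ := by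
  rw [Submodule.topologicalClosure_eq_top_iff, Submodule.eq_bot_iff]
  intro f hf
  obtain ⟨c, hc⟩ := hne
  have hfB : ∀ w : D, (w : ℂ) ∈ B → f w = 0 := by
    intro w hw
    refine ext_inner_left ℂ fun ξ => ?_
    rw [← kerFun_inner, inner_zero_right]
    exact hf _ (Submodule.subset_span ⟨w, ξ, hw, rfl⟩)
  have hext (w : D) : Function.extend Subtype.val (⇑f) 0 (w : ℂ) = f w :=
    Subtype.val_injective.extend_apply _ _ _
  have hz := ((hol f).analyticOnNhd hD).eqOn_zero_of_preconnected_of_eventuallyEq_zero hconn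
    (hBD hc) (by
      filter_upwards [hB.mem_nhds hc] with w hw
      exact (hext ⟨w, hBD hw⟩).trans (hfB ⟨w, hBD hw⟩ hw))
  ext w : 1
  rw [← hext, coe_zero]
  exact hz w.2

end Kernel

section Model

variable {n : ℕ} {D : Set ℂ} {H : Type*} [NormedAddCommGroup H] [InnerProductSpace ℂ H]
  [CompleteSpace H] [RKHS ℂ H D (EuclideanSpace ℂ (Fin n))] {T : H →L[ℂ] H}

/-- The kernel functions at `w` are eigenvectors with eigenvalue `conj w`. -/
lemma IsAdjointMulModel.apply_kerFun (hT : IsAdjointMulModel T) (w : D)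
    (ξ : EuclideanSpace ℂ (Fin n)) : T (kerFun H w ξ) = conj (w : ℂ) • kerFun H w ξ := by
  refine ext_inner_right ℂ fun f => ?_
  rw [← ContinuousLinearMap.adjoint_inner_right, kerFun_inner, hT.adjoint_apply, inner_smul_left,
    inner_smul_right, kerFun_inner, Complex.conj_conj]

lemma kerFun_injective {w : D} (h : IsUnit (kernelMatrix H w w)) :
    Function.Injective (kerFun H w) := by
  have h1 : IsUnit (kernel H w w) := by
    rw [← toEuclideanCLM_kernelMatrix]
    exact h.map Matrix.toEuclideanCLM
  have h2 : Function.Injective (kernel H w w) := by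
    obtain ⟨u, hu⟩ := h1
    refine Function.LeftInverse.injective (g := (u⁻¹ : (_ →L[ℂ] _)ˣ).1) fun x => ?_
    rw [← hu, ← mul_apply_eq_comp, Units.inv_mul, one_apply_eq_self]
  rw [kernel_apply, ContinuousLinearMap.coe_comp] at h2
  exact Function.Injective.of_comp h2

/-- The eigenspace at `conj w` is the range of the kernel function at `w`. -/
lemma IsAdjointMulModel.mem_range_kerFun {Ω : Set ℂ} {H : Type*} [NormedAddCommGroup H]
    [InnerProductSpace ℂ H] [CompleteSpace H]
    [RKHS ℂ H (conjDomain Ω) (EuclideanSpace ℂ (Fin n))] {T : H →L[ℂ] H}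
    (hT : IsAdjointMulModel T) (hcd : CowenDouglas n Ω T) (w : conjDomain Ω) {x : H}
    (hx : T x = conj (w : ℂ) • x) : ∃ ξ, kerFun H w ξ = x := by
  let E := (T - conj (w : ℂ) • ContinuousLinearMap.id ℂ H).ker
  have hE {y : H} : y ∈ E ↔ T y = conj (w : ℂ) • y := by
    simp [E, sub_eq_zero]
  have hrank : Module.finrank ℂ E = n :=
    Module.finrank_eq_of_rank_eq (hcd.rank_ker _ w.2)
  have hfin : FiniteDimensional ℂ E := by
    apply Module.rank_lt_aleph0_iff.1
    rw [hcd.rank_ker _ w.2]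
    exact Cardinal.natCast_lt_aleph0
  have hle : LinearMap.range (kerFun H w).toLinearMap ≤ E := by
    rintro _ ⟨ξ, rfl⟩
    exact hE.2 (hT.apply_kerFun w ξ)
  have heq := Submodule.eq_of_le_of_finrank_eq hle (by
    rw [LinearMap.finrank_range_of_inj (kerFun_injective (hT.isUnit_kernel w)), hrank,
      finrank_euclideanSpace_fin])
  have hxr : x ∈ LinearMap.range (kerFun H w).toLinearMap := by rw [heq]; exact hE.2 hx
  exact hxr

end Model

section Equivalence

variable {n : ℕ} {Ω : Set ℂ} {H_T H_S : Type*}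
  [NormedAddCommGroup H_T] [InnerProductSpace ℂ H_T] [CompleteSpace H_T]
  [NormedAddCommGroup H_S] [InnerProductSpace ℂ H_S] [CompleteSpace H_S]
  [RKHS ℂ H_T (conjDomain Ω) (EuclideanSpace ℂ (Fin n))]
  [RKHS ℂ H_S (conjDomain Ω) (EuclideanSpace ℂ (Fin n))]
  {T : H_T →L[ℂ] H_T} {S : H_S →L[ℂ] H_S}

/-- A unitary intertwining `T` and `S` acts on the kernel functions over each point through a
matrix. -/
lemma exists_matrix_apply_kerFun (hS : CowenDouglas n Ω S) (hTm : IsAdjointMulModel T)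
    (hSm : IsAdjointMulModel S) {U : H_T ≃ₗᵢ[ℂ] H_S} (hU : ∀ x, U (T x) = S (U x))
    (w : conjDomain Ω) : ∃ A : Matrix (Fin n) (Fin n) ℂ, ∀ j,
      U (kerFun H_T w (EuclideanSpace.single j 1)) = kerFun H_S w
        (Matrix.toEuclideanCLM (n := Fin n) (𝕜 := ℂ) A (EuclideanSpace.single j 1)) := by
  have h (j : Fin n) : ∃ η, kerFun H_S w η = U (kerFun H_T w (EuclideanSpace.single j 1)) :=
    hSm.mem_range_kerFun hS w (by rw [← hU, hTm.apply_kerFun, map_smul])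
  choose η hη using h
  refine ⟨Matrix.of fun i j => η j i, fun j => ?_⟩
  rw [← hη]
  congr 1
  ext i
  rw [Matrix.ofLp_toEuclideanCLM]
  simp

lemma exists_gauge_of_unitarilyEquivalent (hΩ : IsOpen Ω) (hne : Ω.Nonempty)
    (hS : CowenDouglas n Ω S) (hTm : IsAdjointMulModel T) (hSm : IsAdjointMulModel S)
    (h : UnitarilyEquivalent T S) :
    ∃ (Λ : Set ℂ) (Ψ : ℂ → Matrix (Fin n) (Fin n) ℂ),
      IsOpen Λ ∧ Λ.Nonempty ∧ Λ ⊆ conjDomain Ω ∧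
      (∀ i j, DifferentiableOn ℂ (fun z => Ψ z i j) Λ) ∧
      (∀ z ∈ Λ, IsUnit (Ψ z)) ∧
      ∀ z ∈ Λ, WirtingerDerivEqZeroAt
        (fun w => (diagKernel H_T w)⁻¹ * (Ψ w)⁻¹ * diagKernel H_S w) z := by
  obtain ⟨U, hU⟩ := h
  obtain ⟨c, hc⟩ := hne
  have hD := isOpen_conjDomain hΩ
  let w₀ : conjDomain Ω := ⟨conj c, by simpa [conjDomain] using hc⟩
  let k (j : Fin n) : H_S := kerFun H_S w₀ (EuclideanSpace.single j 1)
  let Q : ℂ → Matrix (Fin n) (Fin n) ℂ := fun z => Matrix.of fun i j =>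
    Function.extend Subtype.val (⇑(U.symm (k j))) 0 z i
  let K : ℂ → Matrix (Fin n) (Fin n) ℂ := fun z => Matrix.of fun i j =>
    Function.extend Subtype.val (⇑(k j)) 0 z i
  have hQd i j : DifferentiableOn ℂ (fun z => Q z i j) (conjDomain Ω) :=
    differentiableOn_coord hTm.holomorphic _ i
  have hKd i j : DifferentiableOn ℂ (fun z => K z i j) (conjDomain Ω) :=
    differentiableOn_coord hSm.holomorphic _ i
  have hK (w : conjDomain Ω) : K w = kernelMatrix H_S w w₀ := by
    ext i j
    rw [kernelMatrix_apply]
    exact congrArg (fun v : EuclideanSpace ℂ (Fin n) => v i)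
      (Subtype.val_injective.extend_apply (⇑(k j)) 0 w)
  choose A hA using exists_matrix_apply_kerFun hS hTm hSm hU
  have hAT w : kernelMatrix H_T w w = (A w)ᴴ * kernelMatrix H_S w w * A w := by
    ext i j
    rw [← inner_kerFun_single, ← U.inner_map_map, hA, hA, inner_kerFun_toEuclideanCLM,
      inner_single_toEuclideanCLM]
  have hAu w : IsUnit (A w) := by
    have h1 := hTm.isUnit_kernel w
    rw [hAT] at h1
    exact isUnit_of_mul_isUnit_right h1
  have hQ (w : conjDomain Ω) : Q w = (A w)ᴴ * K w := by
    ext i j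
    have h1 : Q w i j = (U.symm (k j)) w i :=
      congrArg (fun v : EuclideanSpace ℂ (Fin n) => v i)
        (Subtype.val_injective.extend_apply (⇑(U.symm (k j))) 0 w)
    have h2 : ⟪kerFun H_T w (EuclideanSpace.single i 1), U.symm (k j)⟫_ℂ = U.symm (k j) w i := by
      rw [kerFun_inner, EuclideanSpace.inner_single_left]
      simp
    have h3 := inner_kerFun_toEuclideanCLM H_S w w₀ (A w) 1
      (EuclideanSpace.single i 1) (EuclideanSpace.single j 1)
    rw [inner_single_toEuclideanCLM, map_one, one_apply_eq_self, Matrix.mul_one] at h3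
    rw [h1, ← h2, ← U.inner_map_map, U.apply_symm_apply, hA, h3, hK]
  let Λ : Set ℂ := conjDomain Ω ∩ {z | (Q z).det ≠ 0}
  have hΛ : IsOpen Λ :=
    (differentiableOn_matrix_det hQd).continuousOn.isOpen_inter_preimage hD isOpen_compl_singleton
  have hsub : Λ ⊆ conjDomain Ω := inter_subset_left
  have hw₀ : (w₀ : ℂ) ∈ Λ := by
    refine ⟨w₀.2, ?_⟩
    have h1 : IsUnit (Q w₀) := by
      rw [hQ, hK]
      exact (hAu w₀).star.mul (hSm.isUnit_kernel w₀)
    exact ((Matrix.isUnit_iff_isUnit_det _).1 h1).ne_zero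
  have hΨ (w : conjDomain Ω) (hw : (w : ℂ) ∈ Λ) : K w * (Q w)⁻¹ = ((A w)ᴴ)⁻¹ := by
    have h1 : IsUnit (Q w).det := isUnit_iff_ne_zero.2 hw.2
    refine (Matrix.inv_eq_right_inv ?_).symm
    rw [← Matrix.mul_assoc, ← hQ, Matrix.mul_nonsing_inv _ h1]
  have hΨd : ∀ i j, DifferentiableOn ℂ (fun z => (K z * (Q z)⁻¹) i j) Λ :=
    differentiableOn_matrix_mul (fun i j => (hKd i j).mono hsub)
      (differentiableOn_matrix_inv (fun i j => (hQd i j).mono hsub) fun z hz => hz.2)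
  refine ⟨Λ, fun z => K z * (Q z)⁻¹, hΛ, ⟨_, hw₀⟩, hsub, hΨd, fun z hz => ?_, fun z hz => ?_⟩
  · have h1 := hΨ ⟨z, hsub hz⟩ hz
    simp only at h1 ⊢
    rw [h1]
    exact Matrix.isUnit_nonsing_inv_iff.2 (hAu _).star
  · have hconj : WirtingerDerivEqZeroAt (fun z => (K z * (Q z)⁻¹)ᴴ) z := fun i j =>
      wirtinger_conj ((hΨd j i).differentiableAt (hΛ.mem_nhds hz))
    refine hconj.congr ?_
    filter_upwards [hΛ.mem_nhds hz] with v hv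
    obtain ⟨w, rfl⟩ : ∃ w : conjDomain Ω, (w : ℂ) = v := ⟨⟨v, hsub hv⟩, rfl⟩
    have hdet : IsUnit ((A w)ᴴ).det := (Matrix.isUnit_iff_isUnit_det _).1 (hAu w).star
    rw [hΨ w hv, Matrix.nonsing_inv_nonsing_inv _ hdet, ← Matrix.conjTranspose_nonsing_inv,
      Matrix.conjTranspose_conjTranspose, diagKernel_apply, diagKernel_apply]
    refine (Matrix.inv_eq_left_inv ?_).symm
    rw [Matrix.mul_assoc, Matrix.mul_assoc, ← Matrix.mul_assoc _ _ (A w), ← hAT]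
    exact Matrix.nonsing_inv_mul _ ((Matrix.isUnit_iff_isUnit_det _).1 (hTm.isUnit_kernel w))

/-- The relation between the diagonals of the kernels polarizes. -/
lemma kernelMatrix_eq_of_wirtinger (hΩ : IsOpen Ω) (hTm : IsAdjointMulModel T)
    (hSm : IsAdjointMulModel S) {Ψ : ℂ → Matrix (Fin n) (Fin n) ℂ} {c : ℂ} {r : ℝ}
    (hball : ball c r ⊆ conjDomain Ω)
    (hΨd : ∀ i j, DifferentiableOn ℂ (fun z => Ψ z i j) (ball c r))
    (hΨu : ∀ z ∈ ball c r, IsUnit (Ψ z))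
    (h : ∀ z ∈ ball c r, WirtingerDerivEqZeroAt
        (fun w => (diagKernel H_T w)⁻¹ * (Ψ w)⁻¹ * diagKernel H_S w) z)
    {z w : conjDomain Ω} (hz : (z : ℂ) ∈ ball c (r / 2)) (hw : (w : ℂ) ∈ ball c (r / 2)) :
    kernelMatrix H_S z w = Ψ z * kernelMatrix H_T z w *
      ((diagKernel H_T w)⁻¹ * (Ψ w)⁻¹ * diagKernel H_S w) := by
  let G : ℂ → Matrix (Fin n) (Fin n) ℂ := fun w =>
    (diagKernel H_T w)⁻¹ * (Ψ w)⁻¹ * diagKernel H_S w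
  have hD := isOpen_conjDomain hΩ
  have hconj {s : ℝ} {u v : ℂ} (hu : v ∈ ball (conj u) s) : conj v ∈ ball u s := by
    rw [mem_ball_iff_norm] at hu ⊢
    rwa [← Complex.norm_conj, map_sub, Complex.conj_conj]
  ext i l
  let f : ℂ × ℂ → ℂ := fun p => (Ψ p.1 * Matrix.of (fun j k => kernelEntry H_T j k p) *
    G (conj p.2)) i l - kernelEntry H_S i l p
  have hfd : DifferentiableOn ℂ f (ball c r ×ˢ ball (conj c) r) := by
    have hprod : ball c r ×ˢ ball (conj c) r ⊆ conjDomain Ω ×ˢ conjDomain (conjDomain Ω) :=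
      prod_mono hball fun u hu => hball (hconj hu)
    refine DifferentiableOn.sub ?_
      ((differentiableOn_kernelEntry hD hSm.holomorphic i l).mono hprod)
    simp only [Matrix.mul_apply]
    refine DifferentiableOn.fun_sum fun k _ => DifferentiableOn.mul
      (DifferentiableOn.fun_sum fun j _ => DifferentiableOn.mul ?_ ?_) ?_
    · exact (hΨd i j).comp differentiableOn_fst fun p hp => hp.1
    · exact (differentiableOn_kernelEntry hD hTm.holomorphic j k).mono hprod
    · have hG : DifferentiableOn ℂ (fun u => G (conj u) k l) (ball (conj c) r) := fun u hu =>
        (differentiableAt_comp_conj_of_wirtinger (f := fun w => G w k l) (h _ (hconj hu) k l).1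
          (h _ (hconj hu) k l).2).differentiableWithinAt
      exact hG.comp differentiableOn_snd fun p hp => hp.2
  have hf0 : ∀ v ∈ ball c r, f (v, conj v) = 0 := by
    intro v hv
    obtain ⟨v, rfl⟩ : ∃ x : conjDomain Ω, (x : ℂ) = v := ⟨⟨v, hball hv⟩, rfl⟩
    have hKu := (Matrix.isUnit_iff_isUnit_det _).1 (hTm.isUnit_kernel v)
    have hΨv := (Matrix.isUnit_iff_isUnit_det _).1 (hΨu _ hv)
    have h1 : Ψ v * kernelMatrix H_T v v * G v = kernelMatrix H_S v v := by
      simp only [G, diagKernel_apply]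
      rw [Matrix.mul_assoc, Matrix.mul_assoc (kernelMatrix H_T v v)⁻¹,
        Matrix.mul_nonsing_inv_cancel_left _ _ hKu, Matrix.mul_nonsing_inv_cancel_left _ _ hΨv]
    simp only [f, Complex.conj_conj, kernelEntry_apply]
    rw [sub_eq_zero, ← h1]
    rfl
  have h1 := eq_zero_of_eq_zero_on_conj hfd hf0 hz
    (hconj (u := conj c) (v := (w : ℂ)) (by simpa using hw))
  simp only [f, Complex.conj_conj, kernelEntry_apply] at h1
  exact (sub_eq_zero.1 h1).symm

lemma unitarilyEquivalent_of_congruence (hΩ : IsOpen Ω) (hconn : IsConnected Ω)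
    (hTm : IsAdjointMulModel T) (hSm : IsAdjointMulModel S) {B : Set ℂ} (hB : IsOpen B)
    (hne : B.Nonempty) (hsub : B ⊆ conjDomain Ω)
    {Φ : {w : conjDomain Ω // (w : ℂ) ∈ B} → Matrix (Fin n) (Fin n) ℂ}
    (hΦ : ∀ z, IsUnit (Φ z))
    (h : ∀ z w, kernelMatrix H_S z.1 w.1 = Φ z * kernelMatrix H_T z.1 w.1 * (Φ w)ᴴ) :
    UnitarilyEquivalent T S := by
  have hD := isOpen_conjDomain hΩ
  have hDc : IsPreconnected (conjDomain Ω) := by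
    have h1 : conjDomain Ω = (fun z => conj z) '' Ω :=
      (congrFun (Function.Involutive.image_eq_preimage_symm Complex.conj_conj) Ω).symm
    rw [h1]
    exact hconn.isPreconnected.image _ Complex.continuous_conj.continuousOn
  let ι := {w : conjDomain Ω // (w : ℂ) ∈ B} × EuclideanSpace ℂ (Fin n)
  let e : ι → H_S := fun p => kerFun H_S p.1.1 p.2
  let f : ι → H_T := fun p => kerFun H_T p.1.1
    (Matrix.toEuclideanCLM (n := Fin n) (𝕜 := ℂ) (Φ p.1)ᴴ p.2)
  have hef (p q : ι) : ⟪e p, e q⟫_ℂ = ⟪f p, f q⟫_ℂ := by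
    simp only [e, f]
    rw [inner_kerFun_toEuclideanCLM, Matrix.conjTranspose_conjTranspose, ← h,
      toEuclideanCLM_kernelMatrix, kerFun_inner, kerFun_apply]
  have he : range e = {x : H_S | ∃ (w : conjDomain Ω) (ξ : EuclideanSpace ℂ (Fin n)),
      (w : ℂ) ∈ B ∧ kerFun H_S w ξ = x} := by
    ext x
    constructor
    · rintro ⟨⟨w, ξ⟩, rfl⟩
      exact ⟨w.1, ξ, w.2, rfl⟩
    · rintro ⟨w, ξ, hw, rfl⟩
      exact ⟨(⟨w, hw⟩, ξ), rfl⟩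
  have hf : range f = {x : H_T | ∃ (w : conjDomain Ω) (ξ : EuclideanSpace ℂ (Fin n)),
      (w : ℂ) ∈ B ∧ kerFun H_T w ξ = x} := by
    ext x
    constructor
    · rintro ⟨⟨w, ξ⟩, rfl⟩
      exact ⟨w.1, _, w.2, rfl⟩
    · rintro ⟨w, ξ, hw, rfl⟩
      have hdet : IsUnit ((Φ ⟨w, hw⟩)ᴴ).det :=
        (Matrix.isUnit_iff_isUnit_det _).1 (hΦ ⟨w, hw⟩).star
      refine ⟨(⟨w, hw⟩,
        Matrix.toEuclideanCLM (n := Fin n) (𝕜 := ℂ) ((Φ ⟨w, hw⟩)ᴴ)⁻¹ ξ), ?_⟩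
      simp only [f]
      rw [← mul_apply_eq_comp, ← map_mul, Matrix.mul_nonsing_inv _ hdet, map_one,
        one_apply_eq_self]
  have hed : (Submodule.span ℂ (range e)).topologicalClosure = ⊤ :=
    he ▸ span_kerFun_dense hD hDc hSm.holomorphic hB hne hsub
  have hfd : (Submodule.span ℂ (range f)).topologicalClosure = ⊤ :=
    hf ▸ span_kerFun_dense hD hDc hTm.holomorphic hB hne hsub
  obtain ⟨V, hV⟩ := exists_linearIsometryEquiv_of_inner_eq hef hed hfd
  have hVS : (V : H_S →L[ℂ] H_T) ∘L S = T ∘L (V : H_S →L[ℂ] H_T) := by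
    refine ContinuousLinearMap.ext_on (Submodule.dense_iff_topologicalClosure_eq_top.2 hed) ?_
    rintro _ ⟨p, rfl⟩
    have h1 : V (S (e p)) = T (V (e p)) := by
      rw [hV, hTm.apply_kerFun, hSm.apply_kerFun, map_smul]
      exact congrArg _ (hV p)
    exact h1
  refine ⟨V.symm, fun x => ?_⟩
  have h1 : V (S (V.symm x)) = T (V (V.symm x)) := DFunLike.congr_fun hVS (V.symm x)
  rw [V.apply_symm_apply] at h1
  rw [← h1, V.symm_apply_apply]

end Equivalence

end CowenDouglasRK

end

theorem theorem3p4 {n : ℕ} (hn : 0 < n) {Ω : Set ℂ} (hΩ_open : IsOpen Ω)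
    (hΩ_conn : IsConnected Ω)
    {H_T H_S : Type*}
    [NormedAddCommGroup H_T] [InnerProductSpace ℂ H_T] [CompleteSpace H_T]
    [NormedAddCommGroup H_S] [InnerProductSpace ℂ H_S] [CompleteSpace H_S]
    [RKHS ℂ H_T (CowenDouglasRK.conjDomain Ω) (EuclideanSpace ℂ (Fin n))]
    [RKHS ℂ H_S (CowenDouglasRK.conjDomain Ω) (EuclideanSpace ℂ (Fin n))]
    (T : H_T →L[ℂ] H_T) (S : H_S →L[ℂ] H_S)
    (hT : CowenDouglasRK.CowenDouglas n Ω T) (hS : CowenDouglasRK.CowenDouglas n Ω S)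
    (hT_model : CowenDouglasRK.IsAdjointMulModel T)
    (hS_model : CowenDouglasRK.IsAdjointMulModel S) :
    CowenDouglasRK.UnitarilyEquivalent T S ↔
      ∃ (Λ : Set ℂ) (Ψ : ℂ → Matrix (Fin n) (Fin n) ℂ),
        IsOpen Λ ∧ Λ.Nonempty ∧ Λ ⊆ CowenDouglasRK.conjDomain Ω ∧
        (∀ i j, DifferentiableOn ℂ (fun z => Ψ z i j) Λ) ∧
        (∀ z ∈ Λ, IsUnit (Ψ z)) ∧
        ∀ z ∈ Λ, CowenDouglasRK.WirtingerDerivEqZeroAt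
          (fun w => (CowenDouglasRK.diagKernel H_T w)⁻¹ * (Ψ w)⁻¹ *
            CowenDouglasRK.diagKernel H_S w) z := by
  refine ⟨CowenDouglasRK.exists_gauge_of_unitarilyEquivalent hΩ_open hΩ_conn.nonempty hS hT_model
    hS_model, ?_⟩
  rintro ⟨Λ, Ψ, hΛ, ⟨c, hc⟩, hsub, hΨd, hΨu, h⟩
  obtain ⟨r, hr, hrΛ⟩ := Metric.isOpen_iff.1 hΛ c hc
  have hhalf : Metric.ball c (r / 2) ⊆ Λ :=
    (Metric.ball_subset_ball (half_le_self hr.le)).trans hrΛ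
  obtain ⟨Φ, hΦ, hK⟩ := CowenDouglasRK.exists_congruence
    (ι := {w : CowenDouglasRK.conjDomain Ω // (w : ℂ) ∈ Metric.ball c (r / 2)})
    (KT := fun z w => CowenDouglasRK.kernelMatrix H_T z.1 w.1)
    (KS := fun z w => CowenDouglasRK.kernelMatrix H_S z.1 w.1)
    (fun _ _ => CowenDouglasRK.conjTranspose_kernelMatrix H_T _ _)
    (fun _ _ => CowenDouglasRK.conjTranspose_kernelMatrix H_S _ _)
    (fun z => CowenDouglasRK.kernelMatrix_posDef (hT_model.isUnit_kernel z.1))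
    (fun z => CowenDouglasRK.kernelMatrix_posDef (hS_model.isUnit_kernel z.1))
    (Ψ := fun z => Ψ z.1) (fun z => hΨu _ (hhalf z.2))
    (fun z w => CowenDouglasRK.kernelMatrix_eq_of_wirtinger hΩ_open hT_model hS_model
      (hrΛ.trans hsub) (fun i j => (hΨd i j).mono hrΛ) (fun z hz => hΨu z (hrΛ hz))
      (fun z hz => h z (hrΛ hz)) z.2 w.2)
  exact CowenDouglasRK.unitarilyEquivalent_of_congruence hΩ_open hΩ_conn hT_model hS_model
    Metric.isOpen_ball ⟨c, Metric.mem_ball_self (half_pos hr)⟩ (hhalf.trans hsub) hΦ hK
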